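/- Let $N\ge 2$ and let $\Sigma$ be the one-sided shift $(\omega_0,\omega_1,\dots)\mapsto(\omega_1,\omega_2,\dots)$ on $\{0,\dots,N-1\}^{\mathbb N_0}$ with the lexicographic order. An order pattern of length $L$ is a permutation $\pi=[\pi_0,\dots,\pi_{L-1}]$ of $\{0,\dots,L-1\}$; a sequence $\omega$ realizes $\pi$ if $\Sigma^{\pi_0}(\omega)<\Sigma^{\pi_1}(\omega)<\dots<\Sigma^{\pi_{L-1}}(\omega)$, and $\pi$ is forbidden if no $\omega$ realizes it. A pattern $\sigma$ of length $L$ is an outgrowth of a pattern $\pi$ of length $K<L$ if, for some integer $n\ge 0$, the numbers $\pi_0+n,\pi_1+n,\dots,\pi_{K-1}+n$ occur in $\sigma$ in this order, from left to right (not necessarily at adjacent positions). A forbidden root pattern is a forbidden pattern that is not an outgrowth of any shorter forbidden pattern. For integers $h_1,\dots,h_D\ge 1$ with $h_1+\dots+h_D=L$ and $D\ge 2$, cut $0,1,\dots,L-1$ into consecutive segments $p_1<p_2<\dots<p_D$ of lengths $h_1,\dots,h_D$, and let $\overleftarrow{p_d}$ be $p_d$ written in decreasing order. The associated spiralling pattern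 is $[\dots,\overleftarrow{p_3},\overleftarrow{p_1},p_2,p_4,\dots]$, and its mirrored pattern is $[\dots,\overleftarrow{p_4},\overleftarrow{p_2},p_1,p_3,\dots]$. Proposition 5. (1) For every $L\ge N+2$, the shift $\Sigma$ has a forbidden root pattern of length $L$. (2) For every partition of $0,1,\dots,L-1$ (any $L$) in $D=N$ segments with $h_1=h_N=2$, the associated spiralling pattern and its mirrored pattern are forbidden root patterns of $\Sigma$. (Such partitions exist exactly for $L\ge N+2$ if $N\ge 3$, and only for $L=4$ if $N=2$.) (3) For $L=N+2$, the spiralling pattern $[\dots,5,3,1,0,2,4,\dots]$ with $N+1$ segments of lengths $h_1=2$, $h_2=\dots=h_{N+1}=1$, and its mirrored pattern, are forbidden root patterns of $\Sigma$. -/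

import Mathlib

namespace OrderPatterns

/-- The point `x` defines (realizes) the order pattern `π = [π 0, …, π (L-1)]` under `T`:
`T^(π 0) x < T^(π 1) x < ⋯ < T^(π (L-1)) x`. -/
def Realizes {X : Type*} [LinearOrder X] (T : X → X) {L : ℕ} (π : Equiv.Perm (Fin L))
    (x : X) : Prop :=
  StrictMono fun i : Fin L => T^[(π i : ℕ)] x

/-- A pattern is forbidden for `T` if no point realizes it. -/
def IsForbidden {X : Type*} [LinearOrder X] (T : X → X) {L : ℕ}
    (π : Equiv.Perm (Fin L)) : Prop :=
  ∀ x : X, ¬ Realizes T π x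

/-- `σ`, of length `L`, is an outgrowth pattern of the strictly shorter pattern `π`, of length `K`:
for some `n` it has the form `[∗, π 0 + n, ∗, π 1 + n, ∗, …, ∗, π (K-1) + n, ∗]`. The map `f`
gives the positions of the entries `π i + n` in `σ`. -/
def IsOutgrowth {K L : ℕ} (π : Equiv.Perm (Fin K)) (σ : Equiv.Perm (Fin L)) : Prop :=
  K < L ∧ ∃ n : ℕ, ∃ f : Fin K ↪o Fin L, ∀ i : Fin K, (σ (f i) : ℕ) = (π i : ℕ) + n

/-- A forbidden root pattern: forbidden, and not an outgrowth of a shorter forbidden pattern. -/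
def IsForbiddenRoot {X : Type*} [LinearOrder X] (T : X → X) {L : ℕ}
    (σ : Equiv.Perm (Fin L)) : Prop :=
  IsForbidden T σ ∧
    ∀ (K : ℕ) (π : Equiv.Perm (Fin K)), IsForbidden T π → ¬ IsOutgrowth π σ

/-- The one-sided shift on `N` symbols, acting on the sequences `ω₀, ω₁, …` over `{0, …, N-1}`
with the lexicographic order. -/
def shift (N : ℕ) (ω : Lex (ℕ → Fin N)) : Lex (ℕ → Fin N) :=
  toLex fun n => ofLex ω (n + 1)

/-- The entries `[π 0, …, π (L-1)]` of an order pattern. -/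
def entries {L : ℕ} (π : Equiv.Perm (Fin L)) : List ℕ :=
  List.ofFn fun i => (π i : ℕ)

/-- Places consecutive segments, of the lengths listed and starting with the number `e`,
alternately on both sides of the list already built: to the left (`left = true`) in decreasing
order, to the right (`left = false`) in increasing order. -/
def spiralFrom : (left : Bool) → (e : ℕ) → (lengths : List ℕ) → (built : List ℕ) → List ℕ
  | _, _, [], built => built
  | true, e, h :: hs, built => spiralFrom false (e + h) hs ((List.range' e h).reverse ++ built)
  | false, e, h :: hs, built => spiralFrom true (e + h) hs (built ++ List.range' e h)

/-- For the partition of `0, 1, …, L-1` in consecutive segments `p₁ < p₂ < ⋯ < p_D` of the given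
lengths, the spiralling pattern `[…, ←p₃, ←p₁, p₂, p₄, …]`, where `←p` is `p` reversed, or, if
`mirrored`, the mirrored pattern `[…, ←p₄, ←p₂, p₁, p₃, …]`. -/
def spiralling (mirrored : Bool) (lengths : List ℕ) : List ℕ :=
  spiralFrom (!mirrored) 0 lengths []

end OrderPatterns

namespace OrderPatterns

/-! ### The shift and the lexicographic order -/

section Shift

variable {N : ℕ}

/-! In a spiralling pattern each number lies below or above all smaller ones, so a realizing orbit
sets a record, low or high, at every step; the direction changes from segment to segment. If the
shift reverses the order of two orbit points, their first symbols differ. Applied at a change of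
direction, this shows that each change costs a symbol beyond the range used so far
(`IsRecordOrbit.exists_symbol_add_le`). Hence `N` changes are impossible, and so are `N - 1` changes
followed by one more record in the last direction, since no point starting with the largest
(smallest) symbol lies strictly below (above) its image.

For the root property it suffices to realize the pattern without its last number and without its
first (`isForbiddenRoot_of_realizes`). A short last segment makes the first restriction end at a
change, and `h₁ = 2` makes the second lose one change. Explicit eventually constant sequences then
work (`exists_isRecordOrbit`). For `N = 2` and general length a separate family of patterns is used.
-/

theorem lex_lt_iff {x y : Lex (ℕ → Fin N)} :
    x < y ↔ ∃ k, (∀ j, j < k → ofLex x j = ofLex y j) ∧ ofLex x k < ofLex y k :=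
  Iff.rfl

theorem ofLex_shift_iterate (ω : Lex (ℕ → Fin N)) (i n : ℕ) :
    ofLex ((shift N)^[i] ω) n = ofLex ω (n + i) := by
  induction i generalizing n with
  | zero => rfl
  | succ i ih =>
    rw [Function.iterate_succ_apply']
    change ofLex ((shift N)^[i] ω) (n + 1) = _
    rw [ih, show n + 1 + i = n + (i + 1) by omega]

theorem shift_iterate_lt_iff {ω : Lex (ℕ → Fin N)} {i j : ℕ} :
    (shift N)^[i] ω < (shift N)^[j] ω ↔
      ∃ k, (∀ l, l < k → ofLex ω (l + i) = ofLex ω (l + j)) ∧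
        ofLex ω (k + i) < ofLex ω (k + j) := by
  simp only [lex_lt_iff, ofLex_shift_iterate]

theorem symbol_le_of_lt {ω : Lex (ℕ → Fin N)} {i j : ℕ}
    (h : (shift N)^[i] ω < (shift N)^[j] ω) : ofLex ω i ≤ ofLex ω j := by
  obtain ⟨k, hk, hlt⟩ := shift_iterate_lt_iff.1 h
  rcases Nat.eq_zero_or_pos k with rfl | hpos
  · simpa using hlt.le
  · simpa using (hk 0 hpos).le

theorem lt_of_symbol_lt {ω : Lex (ℕ → Fin N)} {i j : ℕ} (h : ofLex ω i < ofLex ω j) :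
    (shift N)^[i] ω < (shift N)^[j] ω :=
  shift_iterate_lt_iff.2 ⟨0, by simp, by simpa using h⟩

theorem succ_lt_succ_of_symbol_eq {ω : Lex (ℕ → Fin N)} {i j : ℕ}
    (h : (shift N)^[i] ω < (shift N)^[j] ω) (he : ofLex ω i = ofLex ω j) :
    (shift N)^[i + 1] ω < (shift N)^[j + 1] ω := by
  obtain ⟨k, hk, hlt⟩ := shift_iterate_lt_iff.1 h
  rcases k with _ | k
  · simp [he] at hlt
  · refine shift_iterate_lt_iff.2 ⟨k, fun l hl => ?_, ?_⟩
    · have := hk (l + 1) (by omega)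
      rwa [add_right_comm, add_right_comm l 1 j] at this
    · rwa [add_right_comm, add_right_comm k 1 j] at hlt

theorem lt_of_symbol_le_of_succ_lt {ω : Lex (ℕ → Fin N)} {i j : ℕ}
    (hle : ofLex ω i ≤ ofLex ω j)
    (h : ofLex ω i = ofLex ω j → (shift N)^[i + 1] ω < (shift N)^[j + 1] ω) :
    (shift N)^[i] ω < (shift N)^[j] ω := by
  rcases hle.lt_or_eq with hlt | he
  · exact lt_of_symbol_lt hlt
  · obtain ⟨k, hk, hlt⟩ := shift_iterate_lt_iff.1 (h he)
    refine shift_iterate_lt_iff.2 ⟨k + 1, fun l hl => ?_, ?_⟩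
    · rcases l with _ | l
      · simpa using he
      · have := hk l (by omega)
        rwa [add_right_comm, add_right_comm l 1 j]
    · rwa [add_right_comm, add_right_comm k 1 j]

/-- If the shift reverses the order of two points of the orbit, their first symbols differ. -/
theorem symbol_lt_of_succ_lt {ω : Lex (ℕ → Fin N)} {i j : ℕ}
    (h : (shift N)^[i] ω < (shift N)^[j] ω)
    (h' : (shift N)^[j + 1] ω < (shift N)^[i + 1] ω) : ofLex ω i < ofLex ω j :=
  (symbol_le_of_lt h).lt_of_ne fun he => (succ_lt_succ_of_symbol_eq h he).asymm h'

/-- If a point lies strictly below its image, its first symbol is exceeded later on. -/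
theorem exists_symbol_lt_of_lt_succ {ω : Lex (ℕ → Fin N)} {i : ℕ}
    (h : (shift N)^[i] ω < (shift N)^[i + 1] ω) : ∃ j, ofLex ω i < ofLex ω j := by
  obtain ⟨k, hk, hlt⟩ := shift_iterate_lt_iff.1 h
  -- Before the first disagreement the sequence equals its own shift, hence is constant.
  have hconst : ∀ l, l ≤ k → ofLex ω (l + i) = ofLex ω i := by
    intro l
    induction l with
    | zero => simp
    | succ l ih =>
      intro hl
      rw [← ih (by omega), hk l (by omega), show l + 1 + i = l + (i + 1) by omega]
  exact ⟨_, by rwa [hconst k le_rfl] at hlt⟩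

/-- If a point lies strictly above its image, some later symbol is smaller than its first. -/
theorem exists_symbol_gt_of_succ_lt {ω : Lex (ℕ → Fin N)} {i : ℕ}
    (h : (shift N)^[i + 1] ω < (shift N)^[i] ω) : ∃ j, ofLex ω j < ofLex ω i := by
  obtain ⟨k, hk, hlt⟩ := shift_iterate_lt_iff.1 h
  have hconst : ∀ l, l ≤ k → ofLex ω (l + i) = ofLex ω i := by
    intro l
    induction l with
    | zero => simp
    | succ l ih =>
      intro hl
      rw [← ih (by omega), ← hk l (by omega), show l + 1 + i = l + (i + 1) by omega]
  exact ⟨_, by rwa [hconst k le_rfl] at hlt⟩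

end Shift

/-! ### Criterion for forbidden root patterns -/

/-- Every outgrowth omits the last or the first point of the orbit, so a forbidden pattern is a
root as soon as both of these restrictions are realized. -/
theorem isForbiddenRoot_of_realizes {X : Type*} [LinearOrder X] {T : X → X} {L : ℕ}
    {σ : Equiv.Perm (Fin L)} (hσ : IsForbidden T σ)
    (hinit : ∃ x, ∀ p q, p < q → (σ p : ℕ) + 1 < L → (σ q : ℕ) + 1 < L →
      T^[(σ p : ℕ)] x < T^[(σ q : ℕ)] x)
    (htail : ∃ y, ∀ p q, p < q → 0 < (σ p : ℕ) → 0 < (σ q : ℕ) →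
      T^[(σ p : ℕ) - 1] y < T^[(σ q : ℕ) - 1] y) :
    IsForbiddenRoot T σ := by
  refine ⟨hσ, ?_⟩
  rintro K π hπ ⟨hKL, n, f, hf⟩
  -- For `n = 0` all entries are below `K ≤ L - 1`, so `L - 1` is omitted; for `n > 0` the entry `0`
  -- is.
  rcases Nat.eq_zero_or_pos n with rfl | hn
  · obtain ⟨x, hx⟩ := hinit
    refine hπ x fun i j hij => ?_
    have := hx (f i) (f j) (f.strictMono hij) (by rw [hf]; omega) (by rw [hf]; omega)
    simpa [hf] using this
  · obtain ⟨y, hy⟩ := htail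
    refine hπ (T^[n - 1] y) fun i j hij => ?_
    have := hy (f i) (f j) (f.strictMono hij) (by rw [hf]; omega) (by rw [hf]; omega)
    rw [hf, hf, Nat.add_sub_assoc hn, Nat.add_sub_assoc hn, Function.iterate_add_apply,
      Function.iterate_add_apply] at this
    exact this

theorem exists_perm_entries_eq {L : ℕ} {l : List ℕ} (hl : l.Perm (List.range L)) :
    ∃ σ : Equiv.Perm (Fin L), entries σ = l := by
  have hlen : l.length = L := by simpa using hl.length_eq
  have hlt : ∀ i : Fin L, l.get (i.cast hlen.symm) < L := fun i =>
    List.mem_range.1 (hl.mem_iff.1 (List.get_mem _ _))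
  have hnd : l.Nodup := hl.nodup_iff.2 List.nodup_range
  let g : Fin L → Fin L := fun i => ⟨l.get (i.cast hlen.symm), hlt i⟩
  have hg : Function.Injective g := fun i j hij => by
    have := hnd.injective_get (congrArg Fin.val hij)
    simpa [Fin.ext_iff] using this
  refine ⟨Equiv.ofBijective g (Finite.injective_iff_bijective.1 hg), ?_⟩
  subst hlen
  exact List.ofFn_get l

/-! ### Orbits whose points are successive records -/

/-- Each of the points `T^j x`, `j < L`, is smaller than all earlier ones (`low j = true`) or
larger than all earlier ones (`low j = false`). -/
def IsRecordOrbit {X : Type*} [LinearOrder X] (T : X → X) (low : ℕ → Bool) (L : ℕ) (x : X) :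
    Prop :=
  ∀ i j, i < j → j < L → if low j then T^[j] x < T^[i] x else T^[i] x < T^[j] x

/-- The order of the numbers in which each `b` is placed below (`low b = true`) or above all
smaller numbers. -/
def RecordRel (low : ℕ → Bool) (a b : ℕ) : Prop :=
  (a < b ∧ low b = false) ∨ (b < a ∧ low a = true)

section Record

variable {X : Type*} [LinearOrder X] {T : X → X} {L : ℕ} {σ : Equiv.Perm (Fin L)}
  {low : ℕ → Bool}

theorem IsRecordOrbit.lt_of_recordRel {x : X} (hx : IsRecordOrbit T low L x) {a b : ℕ}
    (ha : a < L) (hb : b < L) (h : RecordRel low a b) : T^[a] x < T^[b] x := by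
  rcases h with ⟨hab, hlow⟩ | ⟨hab, hlow⟩
  · simpa [hlow] using hx a b hab hb
  · simpa [hlow] using hx b a hab ha

theorem isRecordOrbit_of_realizes (hσ : (entries σ).Pairwise (RecordRel low)) {x : X}
    (hx : Realizes T σ x) : IsRecordOrbit T low L x := by
  rw [entries, List.pairwise_ofFn] at hσ
  intro i j hij hj
  obtain ⟨p, hp⟩ := σ.surjective ⟨i, hij.trans hj⟩
  obtain ⟨q, hq⟩ := σ.surjective ⟨j, hj⟩
  have hpi : (σ p : ℕ) = i := by rw [hp]
  have hqj : (σ q : ℕ) = j := by rw [hq]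
  rcases lt_trichotomy p q with h | h | h
  · have hr := hσ h
    have hlt := hx h
    simp only [hpi, hqj] at hr hlt
    rcases hr with ⟨_, hl⟩ | ⟨hl, _⟩
    · simpa [hl] using hlt
    · omega
  · subst h
    omega
  · have hr := hσ h
    have hlt := hx h
    simp only [hpi, hqj] at hr hlt
    rcases hr with ⟨hl, _⟩ | ⟨_, hl⟩
    · omega
    · simpa [hl] using hlt

theorem isForbiddenRoot_of_record (hσ : (entries σ).Pairwise (RecordRel low))
    (hforb : ∀ x, ¬ IsRecordOrbit T low L x)
    (hinit : ∃ x, IsRecordOrbit T low (L - 1) x)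
    (htail : ∃ x, IsRecordOrbit T (fun i => low (i + 1)) (L - 1) x) :
    IsForbiddenRoot T σ := by
  have hrel := hσ
  rw [entries, List.pairwise_ofFn] at hrel
  refine isForbiddenRoot_of_realizes
    (fun x hx => hforb x (isRecordOrbit_of_realizes hσ hx)) ?_ ?_
  · obtain ⟨x, hx⟩ := hinit
    exact ⟨x, fun p q hpq hp hq => hx.lt_of_recordRel (by omega) (by omega) (hrel hpq)⟩
  · obtain ⟨y, hy⟩ := htail
    refine ⟨y, fun p q hpq hp hq => hy.lt_of_recordRel (by omega) (by omega) ?_⟩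
    have h := hrel hpq
    simp only [RecordRel] at h ⊢
    rw [Nat.sub_add_cancel hp, Nat.sub_add_cancel hq]
    rcases h with ⟨h1, h2⟩ | ⟨h1, h2⟩
    · exact Or.inl ⟨by omega, h2⟩
    · exact Or.inr ⟨by omega, h2⟩

end Record

/-! ### Spiralling lists -/

/-- The direction of the segment number `d`, when the segment number `0` has direction `left` and
directions alternate. -/
def segDir (left : Bool) (d : ℕ) : Bool :=
  if d % 2 = 0 then left else !left

theorem segDir_succ (left : Bool) (d : ℕ) : segDir left (d + 1) = segDir (!left) d := by
  rcases Nat.mod_two_eq_zero_or_one d with h | h <;> simp [segDir, h, Nat.add_mod]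

theorem segDir_succ_eq_not (left : Bool) (d : ℕ) : segDir left (d + 1) = !segDir left d := by
  rcases Nat.mod_two_eq_zero_or_one d with h | h <;> simp [segDir, h, Nat.add_mod]

/-- The number of the segment that contains `i`, when `0, 1, 2, …` is cut into consecutive
segments of the listed lengths followed by an infinite one. -/
def segIdx : List ℕ → ℕ → ℕ
  | [], _ => 0
  | h :: hs, i => if i < h then 0 else segIdx hs (i - h) + 1

theorem segIdx_succ_le {hs : List ℕ} (hpos : ∀ h ∈ hs, 0 < h) (i : ℕ) :
    segIdx hs (i + 1) ≤ segIdx hs i + 1 := by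
  induction hs generalizing i with
  | nil => simp [segIdx]
  | cons h hs ih =>
    have hh : 0 < h := hpos h (by simp)
    have hhs : ∀ k ∈ hs, 0 < k := fun k hk => hpos k (by simp [hk])
    simp only [segIdx]
    split_ifs with h1 h2
    · omega
    · omega
    · have he : i + 1 - h = 0 := by omega
      rw [he]
      cases hs with
      | nil => simp [segIdx]
      | cons k ks => simp [segIdx, hhs k (by simp)]
    · have := ih hhs (i - h)
      rw [show i + 1 - h = i - h + 1 by omega]
      omega

theorem segIdx_monotone (hs : List ℕ) : Monotone (segIdx hs) := by
  induction hs with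
  | nil => exact fun _ _ _ => le_rfl
  | cons h hs ih =>
    intro i j hij
    have := ih (Nat.sub_le_sub_right hij h)
    simp only [segIdx]
    split_ifs <;> omega

theorem segIdx_lt_length {hs : List ℕ} {i : ℕ} (hi : i < hs.sum) : segIdx hs i < hs.length := by
  induction hs generalizing i with
  | nil => simp at hi
  | cons h hs ih =>
    simp only [List.sum_cons] at hi
    simp only [segIdx, List.length_cons]
    split_ifs
    · omega
    · have := ih (i := i - h) (by omega)
      omega

theorem segIdx_append_of_lt {l : List ℕ} (r : List ℕ) {i : ℕ} (hi : i < l.sum) :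
    segIdx (l ++ r) i = segIdx l i := by
  induction l generalizing i with
  | nil => simp at hi
  | cons h l ih =>
    simp only [List.sum_cons] at hi
    simp only [segIdx, List.cons_append]
    split_ifs
    · rfl
    · rw [ih (by omega)]

theorem segIdx_append_sum_add {l : List ℕ} (r : List ℕ) (i : ℕ) :
    segIdx (l ++ r) (l.sum + i) = l.length + segIdx r i := by
  induction l with
  | nil => simp
  | cons h l ih =>
    simp only [segIdx, List.cons_append, List.sum_cons, List.length_cons]
    rw [if_neg (by omega), show h + l.sum + i - h = l.sum + i by omega, ih]
    omega

theorem segIdx_replicate_one (n i : ℕ) : segIdx (List.replicate n 1) i = min i n := by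
  induction n generalizing i with
  | zero => simp [segIdx]
  | succ n ih =>
    simp only [List.replicate_succ, segIdx, ih]
    split_ifs <;> omega

theorem spiralFrom_perm (left : Bool) (e : ℕ) (hs built : List ℕ) :
    (spiralFrom left e hs built).Perm (built ++ List.range' e hs.sum) := by
  induction hs generalizing left e built with
  | nil => cases left <;> simp [spiralFrom]
  | cons h hs ih =>
    have hr : List.range' e (h :: hs).sum = List.range' e h ++ List.range' (e + h) hs.sum := by
      rw [List.sum_cons, ← List.range'_append_1]
    rw [hr, ← List.append_assoc]
    cases left
    · exact ih true (e + h) _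
    · refine (ih false (e + h) _).trans (List.Perm.append_right _ ?_)
      exact ((List.reverse_perm _).append_right _).trans List.perm_append_comm

/-- A new segment exceeds every entry of `built` and is placed wholly on one side of it; `hlt` and
`hb` are the invariants of this construction. -/
theorem spiralFrom_pairwise {low : ℕ → Bool} (left : Bool) (e : ℕ) (hs built : List ℕ)
    (hlow : ∀ i, i < hs.sum → low (e + i) = segDir left (segIdx hs i))
    (hlt : ∀ a ∈ built, a < e) (hb : built.Pairwise (RecordRel low)) :
    (spiralFrom left e hs built).Pairwise (RecordRel low) := by
  induction hs generalizing left e built with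
  | nil => cases left <;> simpa [spiralFrom] using hb
  | cons h hs ih =>
    simp only [List.sum_cons] at hlow
    have hfirst : ∀ a ∈ List.range' e h, e ≤ a ∧ low a = left := by
      intro a ha
      rw [List.mem_range'_1] at ha
      refine ⟨ha.1, ?_⟩
      have := hlow (a - e) (by omega)
      rw [Nat.add_sub_cancel' ha.1] at this
      simpa [segIdx, segDir, show a - e < h by omega] using this
    have hrest : ∀ i, i < hs.sum → low (e + h + i) = segDir (!left) (segIdx hs i) := by
      intro i hi
      have := hlow (h + i) (by omega)
      rw [← add_assoc] at this
      rw [this, ← segDir_succ]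
      simp [segIdx]
    cases left
    · refine ih true (e + h) _ hrest ?_ ?_
      · intro a ha
        rcases List.mem_append.1 ha with ha | ha
        · have := hlt a ha
          omega
        · exact (List.mem_range'_1.1 ha).2
      · refine List.pairwise_append.2 ⟨hb, ?_, fun a ha b hb => ?_⟩
        · refine List.Pairwise.imp_of_mem ?_ (List.pairwise_lt_range' (s := e) (n := h))
          exact fun _ hb hab => Or.inl ⟨hab, (hfirst _ hb).2⟩
        · exact Or.inl ⟨(hlt a ha).trans_le (hfirst b hb).1, (hfirst b hb).2⟩
    · refine ih false (e + h) _ hrest ?_ ?_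
      · intro a ha
        rcases List.mem_append.1 ha with ha | ha
        · exact (List.mem_range'_1.1 (List.mem_reverse.1 ha)).2
        · have := hlt a ha
          omega
      · refine List.pairwise_append.2 ⟨?_, hb, fun a ha b hb => ?_⟩
        · rw [List.pairwise_reverse]
          refine List.Pairwise.imp_of_mem ?_ (List.pairwise_lt_range' (s := e) (n := h))
          exact fun _ hb hab => Or.inr ⟨hab, (hfirst _ hb).2⟩
        · have ha' := hfirst a (List.mem_reverse.1 ha)
          exact Or.inr ⟨(hlt b hb).trans_le ha'.1, ha'.2⟩

theorem exists_perm_entries_eq_spiralling {L : ℕ} (mirrored : Bool) {hs : List ℕ}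
    (hsum : hs.sum = L) :
    ∃ σ : Equiv.Perm (Fin L), entries σ = spiralling mirrored hs ∧
      (entries σ).Pairwise (RecordRel fun i => segDir (!mirrored) (segIdx hs i)) := by
  have hperm : (spiralling mirrored hs).Perm (List.range L) := by
    have := spiralFrom_perm (!mirrored) 0 hs []
    rwa [List.nil_append, hsum, ← List.range_eq_range'] at this
  obtain ⟨σ, hσ⟩ := exists_perm_entries_eq hperm
  refine ⟨σ, hσ, ?_⟩
  rw [hσ]
  exact spiralFrom_pairwise _ _ _ _ (fun i _ => by simp) (by simp) List.Pairwise.nil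

/-! ### Record orbits of the shift -/

section ShiftRecord

variable {N : ℕ}

/-- In a record orbit every change of direction makes the range of the symbols grow. -/
theorem IsRecordOrbit.exists_symbol_add_le {s : ℕ → ℕ} {left : Bool} {L : ℕ}
    {ω : Lex (ℕ → Fin N)} (hstep : ∀ i, s (i + 1) ≤ s i + 1) (hmono : Monotone s)
    (hone : s 1 = 0)
    (hω : IsRecordOrbit (shift N) (fun i => segDir left (s i)) L ω) {j : ℕ} (hj : j + 1 < L) :
    ∃ a b, a ≤ j ∧ b ≤ j ∧ (ofLex ω a : ℕ) + s (j + 1) ≤ ofLex ω b := by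
  induction j with
  -- The direction of point `0` is never tested, so a change at point `1` would cost no symbol;
  -- `hone` excludes it.
  | zero => exact ⟨0, 0, by simp [hone]⟩
  | succ j ih =>
    obtain ⟨a, b, ha, hb, hab⟩ := ih (by omega)
    have h1 := hstep (j + 1)
    have h2 : s (j + 1) ≤ s (j + 1 + 1) := hmono (by omega)
    rcases h2.eq_or_lt with h | h
    · exact ⟨a, b, by omega, by omega, by omega⟩
    have hs : s (j + 1 + 1) = s (j + 1) + 1 := by omega
    have hturn : segDir left (s (j + 1 + 1)) = !segDir left (s (j + 1)) := by
      rw [hs, segDir_succ_eq_not]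
    cases hd : segDir left (s (j + 1))
    -- Point `j + 1` is a high record, above `b`, but its image is a low record, below `b + 1`: the
    -- shift reverses the two, so `j + 1` has a larger symbol than `b`.
    · have r1 := hω b (j + 1) (by omega) (by omega)
      have r2 := hω (b + 1) (j + 1 + 1) (by omega) (by omega)
      simp only [hturn, hd, Bool.not_false, if_true, Bool.false_eq_true, if_false] at r1 r2
      have := Fin.lt_def.1 (symbol_lt_of_succ_lt r1 r2)
      exact ⟨a, j + 1, by omega, by omega, by omega⟩
    · have r1 := hω a (j + 1) (by omega) (by omega)
      have r2 := hω (a + 1) (j + 1 + 1) (by omega) (by omega)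
      simp only [hturn, hd, Bool.not_true, if_true, Bool.false_eq_true, if_false] at r1 r2
      have := Fin.lt_def.1 (symbol_lt_of_succ_lt r1 r2)
      exact ⟨j + 1, b, by omega, by omega, by omega⟩

/-- `N` changes would need `N + 1` symbols. -/
theorem not_isRecordOrbit_of_le {s : ℕ → ℕ} {left : Bool} {j : ℕ}
    (hstep : ∀ i, s (i + 1) ≤ s i + 1) (hmono : Monotone s) (hone : s 1 = 0)
    (hs : N ≤ s (j + 1)) (ω : Lex (ℕ → Fin N)) :
    ¬ IsRecordOrbit (shift N) (fun i => segDir left (s i)) (j + 2) ω := by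
  intro hω
  obtain ⟨a, b, -, -, hab⟩ := hω.exists_symbol_add_le hstep hmono hone (j := j) (by omega)
  have := (ofLex ω b).isLt
  omega

/-- After `N - 1` changes both extreme symbols have occurred, so the record at `j + 1` starts with
an extreme one; a further record in the same direction would need a symbol beyond it. -/
theorem not_isRecordOrbit_of_repeat {s : ℕ → ℕ} {left : Bool} {j : ℕ}
    (hstep : ∀ i, s (i + 1) ≤ s i + 1) (hmono : Monotone s) (hone : s 1 = 0)
    (hs : N ≤ s (j + 1) + 1) (hrep : s (j + 2) = s (j + 1)) (ω : Lex (ℕ → Fin N)) :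
    ¬ IsRecordOrbit (shift N) (fun i => segDir left (s i)) (j + 3) ω := by
  intro hω
  obtain ⟨a, b, ha, hb, hab⟩ := hω.exists_symbol_add_le hstep hmono hone (j := j) (by omega)
  have hbN := (ofLex ω b).isLt
  have r := hω (j + 1) (j + 2) (by omega) (by omega)
  cases hd : segDir left (s (j + 1))
  · have r1 := hω b (j + 1) (by omega) (by omega)
    simp only [hrep, hd, Bool.false_eq_true, if_false] at r r1
    have h1 := Fin.le_def.1 (symbol_le_of_lt r1)
    obtain ⟨k, hk⟩ := exists_symbol_lt_of_lt_succ r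
    have h2 := Fin.lt_def.1 hk
    have := (ofLex ω k).isLt
    omega
  · have r1 := hω a (j + 1) (by omega) (by omega)
    simp only [hrep, hd, if_true] at r r1
    have h1 := Fin.le_def.1 (symbol_le_of_lt r1)
    obtain ⟨k, hk⟩ := exists_symbol_gt_of_succ_lt r
    have h2 := Fin.lt_def.1 hk
    omega

/-- Conditions on the symbols of a sequence, with a tail of equal symbols, that make its orbit a
record orbit. -/
theorem isRecordOrbit_of_symbols {low : ℕ → Bool} {m : ℕ} {ω : Lex (ℕ → Fin N)}
    (hlow : ∀ i j, i < j → low j = true →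
      ofLex ω j ≤ ofLex ω i ∧ (low (j + 1) = false → ofLex ω j < ofLex ω i))
    (hhigh : ∀ i j, i < j → low j = false →
      ofLex ω i ≤ ofLex ω j ∧ (low (j + 1) = true → ofLex ω i < ofLex ω j))
    (htail : ∀ k, ofLex ω (m + 1 + k) = ofLex ω (m + 1))
    (hm : ofLex ω m ≠ ofLex ω (m + 1)) :
    IsRecordOrbit (shift N) low (m + 2) ω := by
  -- All points from `m + 1` on coincide; `k` lets both indices advance until `i` reaches `m`, where
  -- `hm` decides.
  have hlast : ∀ d i k, m - i = d → i ≤ m →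
      if low (m + 1) then (shift N)^[m + 1 + k] ω < (shift N)^[i] ω
      else (shift N)^[i] ω < (shift N)^[m + 1 + k] ω := by
    intro d
    induction d with
    | zero =>
      intro i k hd hi
      obtain rfl : i = m := by omega
      cases h : low (i + 1)
      · have := (hhigh i (i + 1) (by omega) h).1.lt_of_ne hm
        exact lt_of_symbol_lt (by rwa [htail])
      · have := (hlow i (i + 1) (by omega) h).1.lt_of_ne hm.symm
        exact lt_of_symbol_lt (by rwa [htail])
    | succ d ih =>
      intro i k hd hi
      have hnext := ih (i + 1) (k + 1) (by omega) (by omega)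
      cases h : low (m + 1)
      · simp only [h, Bool.false_eq_true, if_false] at hnext ⊢
        refine lt_of_symbol_le_of_succ_lt ?_ fun _ => hnext
        rw [htail]
        exact (hhigh i (m + 1) (by omega) h).1
      · simp only [h, if_true] at hnext ⊢
        refine lt_of_symbol_le_of_succ_lt ?_ fun _ => hnext
        rw [htail]
        exact (hlow i (m + 1) (by omega) h).1
  have hall : ∀ d i j, m + 1 - j = d → j ≤ m + 1 → i < j →
      if low j then (shift N)^[j] ω < (shift N)^[i] ω
      else (shift N)^[i] ω < (shift N)^[j] ω := by
    intro d
    induction d with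
    | zero =>
      intro i j hd hj hij
      obtain rfl : j = m + 1 := by omega
      exact hlast _ i 0 rfl (by omega)
    | succ d ih =>
      intro i j hd hj hij
      -- Equal symbols rule out a change at `j + 1`, so the comparison passes to the next pair in
      -- the same direction.
      have hnext := ih (i + 1) (j + 1) (by omega) (by omega) (by omega)
      cases h : low j
      · obtain ⟨hle, hlt⟩ := hhigh i j hij h
        refine lt_of_symbol_le_of_succ_lt hle fun he => ?_
        cases h' : low (j + 1)
        · simpa [h'] using hnext
        · exact absurd he (hlt h').ne
      · obtain ⟨hle, hlt⟩ := hlow i j hij h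
        refine lt_of_symbol_le_of_succ_lt hle fun he => ?_
        cases h' : low (j + 1)
        · exact absurd he (hlt h').ne
        · simpa [h'] using hnext
  exact fun i j hij hj => hall _ i j rfl (by omega) hij

/-- Directions that change at most `N - 1` times, the last time just before the last point, are
those of a record orbit of the shift on `N` symbols. -/
theorem exists_isRecordOrbit {s : ℕ → ℕ} (left : Bool) {m : ℕ}
    (hstep : ∀ i, s (i + 1) ≤ s i + 1) (hmono : Monotone s)
    (hlast : s m < s (m + 1)) (hN : s (m + 1) < N) :
    ∃ ω, IsRecordOrbit (shift N) (fun i => segDir left (s i)) (m + 2) ω := by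
  obtain ⟨K, hK⟩ : ∃ K, K = s (m + 1) := ⟨_, rfl⟩
  -- Capping at `K` makes the symbols constant from `m + 1` on.
  obtain ⟨t, ht⟩ : ∃ t : ℕ → ℕ, ∀ i, t i = min (s i) K := ⟨_, fun _ => rfl⟩
  have htK : ∀ i, t i ≤ K := fun i => by rw [ht]; exact min_le_right _ _
  have htmono : ∀ i j, i ≤ j → t i ≤ t j := fun i j hij => by
    have := hmono hij
    rw [ht, ht]
    omega
  have htail : ∀ k, t (m + 1 + k) = K := fun k => by
    have : s (m + 1) ≤ s (m + 1 + k) := hmono (by omega)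
    rw [ht]
    omega
  have htm : t m + 1 = K := by
    have := hstep m
    rw [ht]
    omega
  -- Low points have even `t j`. Starting from `(K + 1) / 2`, the last point before each change
  -- takes a fresh symbol just outside the used range, as `t (j + 1)` registers the coming change;
  -- other points repeat the extreme symbol on their side. The values fill `0, …, K`.
  obtain ⟨v, hv⟩ : ∃ v : ℕ → ℕ, ∀ j, v j =
      if t j % 2 = 0 then (K + 1) / 2 - (t (j + 1) + 1) / 2 else (K + 1) / 2 + t (j + 1) / 2 :=
    ⟨_, fun _ => rfl⟩
  have hvK : ∀ j, v j ≤ K := fun j => by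
    have := htK (j + 1)
    rw [hv]
    split_ifs <;> omega
  have hveven : ∀ i j, i < j → t j % 2 = 0 →
      v j ≤ v i ∧ (t (j + 1) % 2 = 1 → v j < v i) := fun i j hij hj => by
    have h1 := htmono (i + 1) j (by omega)
    have h2 := htmono j (j + 1) (by omega)
    have h3 := htK (j + 1)
    rw [hv i, hv j, if_pos hj]
    split_ifs <;> omega
  have hvodd : ∀ i j, i < j → t j % 2 = 1 →
      v i ≤ v j ∧ (t (j + 1) % 2 = 0 → v i < v j) := fun i j hij hj => by
    have h1 := htmono (i + 1) j (by omega)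
    have h2 := htmono j (j + 1) (by omega)
    have h3 := htK (j + 1)
    rw [hv i, hv j, if_neg (show ¬ t j % 2 = 0 by omega)]
    split_ifs <;> omega
  have hvtail : ∀ k, v (m + 1 + k) = v (m + 1) := fun k => by
    have h1 := htail k
    have h2 := htail (k + 1)
    have h3 := htail 0
    have h4 := htail 1
    simp only [add_zero, ← add_assoc] at h1 h2 h3 h4
    rw [hv, hv, h1, h2, h3, h4]
  have hvm : v m ≠ v (m + 1) := by
    have h3 := htail 0
    have h4 := htail 1
    simp only [add_zero] at h3 h4
    rw [hv, hv, h3, h4]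
    split_ifs <;> omega
  -- Reversing the alphabet handles an initial high direction.
  let ω : Lex (ℕ → Fin N) := toLex fun j =>
    ⟨if left then v j else K - v j, by have := hvK j; split_ifs <;> omega⟩
  have hω : ∀ j, (ofLex ω j : ℕ) = if left then v j else K - v j := fun _ => rfl
  have key : IsRecordOrbit (shift N) (fun i => segDir left (t i)) (m + 2) ω := by
    refine isRecordOrbit_of_symbols ?_ ?_ ?_ ?_
    · intro i j hij hj
      have h1 := hvK i
      have h2 := hvK j
      rw [Fin.le_def, Fin.lt_def, hω, hω]
      cases left
      · have hj' : t j % 2 = 1 := by simpa [segDir] using hj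
        have h := hvodd i j hij hj'
        simp only [segDir, Bool.false_eq_true, if_false]
        refine ⟨by omega, fun hh => ?_⟩
        have := h.2 (by simpa using hh)
        omega
      · have hj' : t j % 2 = 0 := by simpa [segDir] using hj
        have h := hveven i j hij hj'
        simp only [segDir, if_true]
        exact ⟨h.1, fun hh => h.2 (by simpa using hh)⟩
    · intro i j hij hj
      have h1 := hvK i
      have h2 := hvK j
      rw [Fin.le_def, Fin.lt_def, hω, hω]
      cases left
      · have hj' : t j % 2 = 0 := by simpa [segDir] using hj
        have h := hveven i j hij hj'
        simp only [segDir, Bool.false_eq_true, if_false]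
        refine ⟨by omega, fun hh => ?_⟩
        have := h.2 (by simpa using hh)
        omega
      · have hj' : t j % 2 = 1 := by simpa [segDir] using hj
        have h := hvodd i j hij hj'
        simp only [segDir, if_true]
        exact ⟨h.1, fun hh => h.2 (by simpa using hh)⟩
    · intro k
      rw [Fin.ext_iff, hω, hω, hvtail]
    · have h1 := hvK m
      have h2 := hvK (m + 1)
      rw [Ne, Fin.ext_iff, hω, hω]
      split_ifs <;> omega
  refine ⟨ω, fun i j hij hj => ?_⟩
  have h := key i j hij hj
  have : t j = s j := by
    have : s j ≤ s (m + 1) := hmono (by omega)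
    rw [ht]
    omega
  simpa only [this] using h

end ShiftRecord

/-! ### The forbidden root patterns -/

section Roots

variable {N : ℕ}

/-- A spiralling pattern whose second segment begins with 2 is a forbidden root if it is
forbidden and its directions change at most `N - 1` times in either of its restrictions. -/
theorem isForbiddenRoot_of_segIdx {left : Bool} {hs : List ℕ} {m : ℕ}
    {σ : Equiv.Perm (Fin (m + 3))} (hpos : ∀ h ∈ hs, 0 < h)
    (htwo : segIdx hs 2 = 1)
    (hσ : (entries σ).Pairwise (RecordRel fun i => segDir left (segIdx hs i)))
    (hforb : ∀ ω, ¬ IsRecordOrbit (shift N) (fun i => segDir left (segIdx hs i)) (m + 3) ω)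
    (hinit : segIdx hs m < segIdx hs (m + 1)) (hinitN : segIdx hs (m + 1) < N)
    (htail : ∃ ω, IsRecordOrbit (shift N) (fun i => segDir (!left) (segIdx hs (i + 1) - 1))
      (m + 2) ω) :
    IsForbiddenRoot (shift N) σ := by
  have hmono := segIdx_monotone hs
  refine isForbiddenRoot_of_record hσ hforb
    (exists_isRecordOrbit left (segIdx_succ_le hpos) hmono hinit hinitN) ?_
  obtain ⟨ω, hω⟩ := htail
  refine ⟨ω, fun i j hij hj => ?_⟩
  have h := hω i j hij hj
  -- Here `j ≥ 1`, so subtracting `1` is exact; truncation can occur only at index `0`, whose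
  -- direction is never tested.
  have h2 : segIdx hs 2 ≤ segIdx hs (j + 1) := hmono (by omega)
  have h3 : segDir left (segIdx hs (j + 1)) = segDir (!left) (segIdx hs (j + 1) - 1) := by
    rw [← segDir_succ, Nat.sub_add_cancel (by omega)]
  simpa only [h3] using h

theorem exists_isForbiddenRoot_spiralling_of_blocks (hN : 2 ≤ N) {L : ℕ} {hs : List ℕ}
    (hpos : ∀ h ∈ hs, 0 < h) (hsum : hs.sum = L) (hlen : hs.length = N)
    (hhead : hs.head? = some 2) (hlast : hs.getLast? = some 2) (mirrored : Bool) :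
    ∃ σ : Equiv.Perm (Fin L),
      entries σ = spiralling mirrored hs ∧ IsForbiddenRoot (shift N) σ := by
  obtain ⟨r, hr⟩ : ∃ r, hs = 2 :: r := by
    cases hs with
    | nil => simp at hhead
    | cons a r => exact ⟨r, by simpa using hhead⟩
  obtain ⟨l, hl⟩ := List.getLast?_eq_some_iff.1 hlast
  have hll : l.length + 1 = N := by rw [← hlen, hl]; simp
  have hlsum : l.sum + 2 = L := by rw [← hsum, hl]; simp
  have hl2 : 2 ≤ l.sum := by
    cases l with
    | nil => simp at hll; omega
    | cons a l =>
      have : a = 2 := by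
        rw [hl] at hhead
        simpa using hhead
      simp [this]
  obtain ⟨m, hm⟩ : ∃ m, l.sum = m + 1 := ⟨l.sum - 1, by omega⟩
  obtain rfl : L = m + 3 := by omega
  have hone : segIdx hs 1 = 0 := by rw [hr]; simp [segIdx]
  have htwo : segIdx hs 2 = 1 := by
    have h1 : segIdx hs 2 ≤ segIdx hs 1 + 1 := segIdx_succ_le hpos 1
    have h2 : segIdx hs 2 ≠ 0 := by rw [hr]; simp [segIdx]
    omega
  have hm0 : segIdx hs m < N - 1 := by
    rw [hl, segIdx_append_of_lt _ (by omega)]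
    have := segIdx_lt_length (hs := l) (i := m) (by omega)
    omega
  have hm1 : segIdx hs (m + 1) = N - 1 := by
    rw [hl, ← hm, ← add_zero l.sum, segIdx_append_sum_add]
    simp only [segIdx]
    simp
    omega
  have hm2 : segIdx hs (m + 2) = N - 1 := by
    rw [hl, show m + 2 = l.sum + 1 by omega, segIdx_append_sum_add]
    simp only [segIdx]
    simp
    omega
  have hm3 : segIdx hs (m + 3) = N := by
    rw [hl, show m + 3 = l.sum + 2 by omega, segIdx_append_sum_add]
    simp only [segIdx]
    simp
    omega
  have hmono := segIdx_monotone hs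
  have hstep := segIdx_succ_le hpos
  obtain ⟨σ, hσ, hrec⟩ := exists_perm_entries_eq_spiralling mirrored hsum
  refine ⟨σ, hσ, isForbiddenRoot_of_segIdx hpos htwo hrec
    (not_isRecordOrbit_of_repeat hstep hmono hone (by omega) (by omega))
    (by omega) (by omega) ?_⟩
  -- This restriction has only `N - 2` changes and does not end at one. It is prolonged by a point
  -- past the last segment, where `segIdx` jumps to `N`, giving a final change.
  obtain ⟨ω, hω⟩ := exists_isRecordOrbit (N := N) (s := fun i => segIdx hs (i + 1) - 1)
    (!!mirrored) (m := m + 1)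
    (fun i => by have := hstep (i + 1); omega)
    (fun i j hij => Nat.sub_le_sub_right (hmono (by omega)) 1)
    (by simp only [hm2, hm3]; omega) (by simp only [hm3]; omega)
  exact ⟨ω, fun i j hij hj => hω i j hij (by omega)⟩

theorem exists_isForbiddenRoot_spiralling_replicate (hN : 2 ≤ N) (mirrored : Bool) :
    ∃ σ : Equiv.Perm (Fin (N + 2)),
      entries σ = spiralling mirrored (2 :: List.replicate N 1) ∧
        IsForbiddenRoot (shift N) σ := by
  obtain ⟨m, rfl⟩ : ∃ m, N = m + 1 := ⟨N - 1, by omega⟩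
  have hpos : ∀ h ∈ 2 :: List.replicate (m + 1) 1, 0 < h := by
    intro h hh
    rcases List.mem_cons.1 hh with rfl | hh
    · omega
    · rw [List.eq_of_mem_replicate hh]
      omega
  have hidx : ∀ i, i ≤ m + 2 → segIdx (2 :: List.replicate (m + 1) 1) i = i - 1 := by
    intro i hi
    simp only [segIdx, segIdx_replicate_one]
    split_ifs <;> omega
  have hmono := segIdx_monotone (2 :: List.replicate (m + 1) 1)
  have hstep := segIdx_succ_le hpos
  obtain ⟨σ, hσ, hrec⟩ := exists_perm_entries_eq_spiralling mirrored
    (hs := 2 :: List.replicate (m + 1) 1) (L := m + 1 + 2) (by simp; omega)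
  have hone := hidx 1 (by omega)
  have htwo := hidx 2 (by omega)
  have hm0 := hidx m (by omega)
  have hm1 := hidx (m + 1) (by omega)
  have hm2 := hidx (m + 2) (by omega)
  refine ⟨σ, hσ, isForbiddenRoot_of_segIdx (m := m) hpos htwo hrec
    (not_isRecordOrbit_of_le (j := m + 1) hstep hmono hone hm2.ge)
    (by omega) (by omega) ?_⟩
  exact exists_isRecordOrbit (s := fun i => segIdx (2 :: List.replicate (m + 1) 1) (i + 1) - 1)
    (!!mirrored) (fun i => by have := hstep (i + 1); omega)
    (fun i j hij => Nat.sub_le_sub_right (hmono (by omega)) 1)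
    (by simp only [hm1, hm2]; omega) (by simp only [hm2]; omega)

/-- The pattern `[1, …, n + 1, 0, n + 2, n + 3]` is a forbidden root of the shift on two
symbols. -/
theorem exists_isForbiddenRoot_shift_two (n : ℕ) :
    ∃ σ : Equiv.Perm (Fin (n + 4)), IsForbiddenRoot (shift 2) σ := by
  have hperm : (List.range' 1 (n + 1) ++ 0 :: [n + 2, n + 3]).Perm (List.range (n + 4)) := by
    have : List.range (n + 4) = 0 :: (List.range' 1 (n + 1) ++ [n + 2, n + 3]) := by
      rw [List.range_eq_range', show [n + 2, n + 3] = List.range' (1 + (n + 1)) 2 by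
        simp [List.range'_succ]; omega, List.range'_append_1]
      rfl
    rw [this]
    exact List.perm_middle
  obtain ⟨σ, hσ⟩ := exists_perm_entries_eq hperm
  have hpw : (entries σ).Pairwise fun a b =>
      (0 < a ∧ a < b) ∨ (b = 0 ∧ 0 < a ∧ a ≤ n + 1) ∨ (a = 0 ∧ n + 2 ≤ b) := by
    rw [hσ]
    refine List.pairwise_append.2 ⟨?_, ?_, ?_⟩
    · refine List.Pairwise.imp_of_mem ?_ (List.pairwise_lt_range' (s := 1) (n := n + 1))
      intro a b ha _ hab
      have := List.mem_range'_1.1 ha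
      omega
    · simp
    · intro a ha b hb
      have := List.mem_range'_1.1 ha
      simp only [List.mem_cons, List.not_mem_nil, or_false] at hb
      omega
  rw [entries, List.pairwise_ofFn] at hpw
  refine ⟨σ, isForbiddenRoot_of_realizes ?_ ?_ ?_⟩
  · intro ω hω
    have hlt : ∀ a b, a < n + 4 → b < n + 4 →
        ((0 < a ∧ a < b) ∨ (b = 0 ∧ 0 < a ∧ a ≤ n + 1) ∨ (a = 0 ∧ n + 2 ≤ b)) →
        (shift 2)^[a] ω < (shift 2)^[b] ω := by
      intro a b ha hb h
      obtain ⟨p, hp⟩ := σ.surjective ⟨a, ha⟩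
      obtain ⟨q, hq⟩ := σ.surjective ⟨b, hb⟩
      have hpa : (σ p : ℕ) = a := by rw [hp]
      have hqb : (σ q : ℕ) = b := by rw [hq]
      rcases lt_trichotomy p q with hpq | rfl | hpq
      · have := hω hpq
        simp only [hpa, hqb] at this
        exact this
      · omega
      · have := hpw hpq
        simp only [hpa, hqb] at this
        omega
    -- The reversal of `n + 1` and `0` forces `ω₀ = 1`, hence symbol `1` at `n + 2`, which no later
    -- symbol can exceed.
    have h0 := symbol_lt_of_succ_lt (hlt (n + 1) 0 (by omega) (by omega) (by omega))
      (hlt 1 (n + 2) (by omega) (by omega) (by omega))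
    have h1 := symbol_le_of_lt (hlt 0 (n + 2) (by omega) (by omega) (by omega))
    obtain ⟨k, hk⟩ := exists_symbol_lt_of_lt_succ
      (hlt (n + 2) (n + 3) (by omega) (by omega) (by omega))
    omega
  -- The sequence `1 0ⁿ⁺¹ 1^∞`.
  · let ω : Lex (ℕ → Fin 2) := toLex fun k => if k = 0 ∨ n + 2 ≤ k then 1 else 0
    have hω : ∀ k, ofLex ω k = if k = 0 ∨ n + 2 ≤ k then 1 else 0 := fun _ => rfl
    refine ⟨ω, fun p q hpq hp hq => ?_⟩
    have h := hpw hpq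
    generalize (σ p : ℕ) = a at *
    generalize (σ q : ℕ) = b at *
    rcases h with ⟨ha, hab⟩ | ⟨rfl, ha, hab⟩ | ⟨rfl, hb⟩
    · refine shift_iterate_lt_iff.2 ⟨n + 2 - b, fun l hl => ?_, ?_⟩
      · rw [hω, hω, if_neg (by omega), if_neg (by omega)]
      · rw [hω, hω, if_neg (by omega), if_pos (by omega)]
        exact Fin.zero_lt_one
    · refine lt_of_symbol_lt ?_
      rw [hω, hω, if_neg (by omega), if_pos (by omega)]
      exact Fin.zero_lt_one
    · refine shift_iterate_lt_iff.2 ⟨1, fun l hl => ?_, ?_⟩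
      · rw [hω, hω, if_pos (by omega), if_pos (by omega)]
      · rw [hω, hω, if_neg (by omega), if_pos (by omega)]
        exact Fin.zero_lt_one
  -- Without `0` the pattern is increasing: `0ⁿ⁺² 1^∞` loses one leading zero at each step.
  · let ω : Lex (ℕ → Fin 2) := toLex fun k => if n + 2 ≤ k then 1 else 0
    have hω : ∀ k, ofLex ω k = if n + 2 ≤ k then 1 else 0 := fun _ => rfl
    refine ⟨ω, fun p q hpq hp hq => ?_⟩
    have h := hpw hpq
    have hqL := (σ q).isLt
    generalize (σ p : ℕ) = a at *
    generalize (σ q : ℕ) = b at *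
    refine shift_iterate_lt_iff.2 ⟨n + 3 - b, fun l hl => ?_, ?_⟩
    · rw [hω, hω, if_neg (by omega), if_neg (by omega)]
    · rw [hω, hω, if_neg (by omega), if_pos (by omega)]
      exact Fin.zero_lt_one

end Roots

end OrderPatterns

theorem proposition5 (N : ℕ) (hN : 2 ≤ N) :
    -- forbidden root patterns exist in every length `L ≥ N + 2`
    (∀ L : ℕ, N + 2 ≤ L →
      ∃ σ : Equiv.Perm (Fin L),
        OrderPatterns.IsForbiddenRoot (OrderPatterns.shift N) σ) ∧
    -- the spiralling patterns, plain and mirrored, of the partitions of `0, …, L - 1` in `N`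
    -- segments with first and last segment of length 2
    (∀ (L : ℕ) (h : Composition L), h.length = N →
      h.blocks.head? = some 2 → h.blocks.getLast? = some 2 →
      ∀ mirrored : Bool, ∃ σ : Equiv.Perm (Fin L),
        OrderPatterns.entries σ = OrderPatterns.spiralling mirrored h.blocks ∧
        OrderPatterns.IsForbiddenRoot (OrderPatterns.shift N) σ) ∧
    -- in the smallest length `N + 2`, also `[…, 5, 3, 1, 0, 2, 4, …]`, plain and mirrored
    (∀ mirrored : Bool, ∃ σ : Equiv.Perm (Fin (N + 2)),
        OrderPatterns.entries σ = OrderPatterns.spiralling mirrored (2 :: List.replicate N 1) ∧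
        OrderPatterns.IsForbiddenRoot (OrderPatterns.shift N) σ) := by
  refine ⟨fun L hL => ?_, fun L h hlen hhead hlast mirrored => ?_, fun mirrored => ?_⟩
  · rcases hN.eq_or_lt with rfl | hN3
    -- Two segments of length 2 give only `L = 4`, hence the separate family.
    · obtain ⟨n, rfl⟩ := Nat.exists_eq_add_of_le' hL
      exact OrderPatterns.exists_isForbiddenRoot_shift_two n
    -- For `N ≥ 3` a middle segment of length `L - N - 1 ≥ 1` absorbs the excess length.
    · obtain ⟨σ, -, hσ⟩ := OrderPatterns.exists_isForbiddenRoot_spiralling_of_blocks hN (L := L)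
        (hs := 2 :: (List.replicate (N - 3) 1 ++ [L - N - 1, 2]))
        (by
          intro h hh
          simp only [List.mem_cons, List.mem_append, List.mem_replicate, List.not_mem_nil,
            or_false] at hh
          omega)
        (by simp; omega) (by simp; omega) (by simp)
        (List.getLast?_eq_some_iff.2 ⟨2 :: (List.replicate (N - 3) 1 ++ [L - N - 1]), by simp⟩)
        false
      exact ⟨σ, hσ⟩
  · exact OrderPatterns.exists_isForbiddenRoot_spiralling_of_blocks hN
      (fun _ hh => h.blocks_pos hh) h.blocks_sum hlen hhead hlast mirrored
  · exact OrderPatterns.exists_isForbiddenRoot_spiralling_replicate hN mirrored
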